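/- Let $C([0,\infty])$ be the Banach space of continuous (real- or complex-valued) functions on $[0,\infty)$ that have a finite limit at $+\infty$, with the sup-norm $\|\cdot\|_\infty$. For $\gamma,b>0$ let $A^{\gamma,b}$ be the operator $A^{\gamma,b}u(x)=\gamma x u''(x)+b u'(x)$ in $C([0,\infty])$ with domain $$D(A^{\gamma,b})=\Big\{u\in C^1([0,\infty))\cap C^2((0,\infty))\cap C([0,\infty])\ :\ \lim_{x\to0^+}x u''(x)=0,\ \lim_{x\to+\infty}A^{\gamma,b}u(x)=0\Big\},$$ where $A^{\gamma,b}u(0)=b\,u'(0)$ is the continuous extension to $x=0$. Let $\gamma>0$. There is a constant $C>0$, independent of $b$, such that for every $b>0$ and every $\lambda>0$ the number $\lambda$ belongs to the resolvent set of $A^{\gamma,b}$ and the resolvent $R(\lambda,A^{\gamma,b})=(\lambda I-A^{\gamma,b})^{-1}$ satisfies, for all $f\in C([0,\infty])$, $$\sup_{x>0}\big|x\,(R(\lambda,A^{\gamma,b})f)''(x)\big|\le \frac C\gamma\Big[1+\max\Big\{\frac{2b}{\gamma},1\Big\}\Big]\|f\|_\infty .$$ -/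

import Mathlib

open Set Filter Topology
open scoped NNReal BoundedContinuousFunction

namespace DegenerateDiffusion

/-- The space `C([0,∞])` of continuous functions `[0,∞) → 𝕜` that converge at infinity.  It is
realised inside the bounded continuous functions (a continuous function that converges at infinity
is bounded), from which it inherits the sup-norm. -/
def CInfty (𝕜 : Type*) [RCLike 𝕜] : Submodule 𝕜 (ℝ≥0 →ᵇ 𝕜) where
  carrier := {f | ∃ l : 𝕜, Tendsto f atTop (𝓝 l)}
  zero_mem' := ⟨0, tendsto_const_nhds⟩
  add_mem' := by
    rintro f g ⟨l, hl⟩ ⟨m, hm⟩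
    exact ⟨l + m, hl.add hm⟩
  smul_mem' := by
    rintro c f ⟨l, hl⟩
    exact ⟨c • l, hl.const_smul c⟩

variable {𝕜 : Type*} [RCLike 𝕜]

/-- A function on `[0,∞)` viewed as a function on `ℝ` (constant on the negative half-line), so that
its derivatives on `(0,∞)` and its one-sided derivative at `0` can be written down. -/
def onReal (u : ℝ≥0 → 𝕜) : ℝ → 𝕜 := fun x => u x.toNNReal

/-- The differential expression `γ x u''(x) + b u'(x)`, `x ≥ 0`.  The derivative `u'` is one-sided
at `x = 0`; there the first summand is `0`, which is the value of its continuous extension for the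
functions `u` in the domain below. -/
noncomputable def diffExpr (γ b : ℝ) (u : ℝ≥0 → 𝕜) (x : ℝ≥0) : 𝕜 :=
  ((γ * x : ℝ) : 𝕜) * deriv (deriv (onReal u)) x +
    (b : 𝕜) * derivWithin (onReal u) (Ici 0) x

/-- Membership in the domain `D(A^{γ,b})`, `b > 0`: the function `u ∈ C([0,∞])` is in
`C¹([0,∞)) ∩ C²((0,∞))`, `x u''(x) → 0` as `x → 0⁺`, and
`γ x u''(x) + b u'(x) → 0` as `x → +∞`. -/
structure MemDomain (γ b : ℝ) (u : ℝ≥0 → 𝕜) : Prop where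
  contDiffOn_one : ContDiffOn ℝ 1 (onReal u) (Ici 0)
  contDiffOn_two : ContDiffOn ℝ 2 (onReal u) (Ioi 0)
  tendsto_zero : Tendsto (fun x : ℝ => (x : 𝕜) * deriv (deriv (onReal u)) x) (𝓝[>] 0) (𝓝 0)
  tendsto_atTop : Tendsto (diffExpr γ b u) atTop (𝓝 0)

/-! ### Linearity and continuity of the differential expression on the domain -/

lemma MemDomain.differentiableAt {γ b : ℝ} {u : ℝ≥0 → 𝕜} (h : MemDomain γ b u) {x : ℝ}
    (hx : 0 < x) : DifferentiableAt ℝ (onReal u) x :=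
  (h.contDiffOn_two.differentiableOn (by norm_num)).differentiableAt (Ioi_mem_nhds hx)

lemma MemDomain.contDiffOn_deriv {γ b : ℝ} {u : ℝ≥0 → 𝕜} (h : MemDomain γ b u) :
    ContDiffOn ℝ 1 (deriv (onReal u)) (Ioi 0) :=
  h.contDiffOn_two.deriv_of_isOpen isOpen_Ioi (by norm_num)

lemma MemDomain.differentiableAt_deriv {γ b : ℝ} {u : ℝ≥0 → 𝕜} (h : MemDomain γ b u) {x : ℝ}
    (hx : 0 < x) : DifferentiableAt ℝ (deriv (onReal u)) x :=
  (h.contDiffOn_deriv.differentiableOn (by norm_num)).differentiableAt (Ioi_mem_nhds hx)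

lemma MemDomain.differentiableWithinAt {γ b : ℝ} {u : ℝ≥0 → 𝕜} (h : MemDomain γ b u) {x : ℝ}
    (hx : 0 ≤ x) : DifferentiableWithinAt ℝ (onReal u) (Ici 0) x :=
  h.contDiffOn_one.differentiableOn (by norm_num) x hx

lemma MemDomain.deriv_deriv_add {γ b : ℝ} {u v : ℝ≥0 → 𝕜} (hu : MemDomain γ b u)
    (hv : MemDomain γ b v) {x : ℝ} (hx : 0 < x) :
    deriv (deriv (onReal (u + v))) x = deriv (deriv (onReal u)) x + deriv (deriv (onReal v)) x := by
  have h : deriv (onReal (u + v)) =ᶠ[𝓝 x] deriv (onReal u) + deriv (onReal v) := by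
    filter_upwards [Ioi_mem_nhds hx] with y hy
    exact deriv_add (hu.differentiableAt hy) (hv.differentiableAt hy)
  rw [h.deriv_eq]
  exact deriv_add (hu.differentiableAt_deriv hx) (hv.differentiableAt_deriv hx)

lemma MemDomain.deriv_deriv_smul {γ b : ℝ} {u : ℝ≥0 → 𝕜} (hu : MemDomain γ b u) (c : 𝕜) {x : ℝ}
    (hx : 0 < x) :
    deriv (deriv (onReal (c • u))) x = c * deriv (deriv (onReal u)) x := by
  have h : deriv (onReal (c • u)) =ᶠ[𝓝 x] fun y => c * deriv (onReal u) y := by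
    filter_upwards [Ioi_mem_nhds hx] with y hy
    exact deriv_const_mul c (hu.differentiableAt hy)
  rw [h.deriv_eq]
  exact deriv_const_mul c (hu.differentiableAt_deriv hx)

lemma MemDomain.diffExpr_add {γ b : ℝ} {u v : ℝ≥0 → 𝕜} (hu : MemDomain γ b u)
    (hv : MemDomain γ b v) : diffExpr γ b (u + v) = diffExpr γ b u + diffExpr γ b v := by
  funext x
  have h1 : derivWithin (onReal (u + v)) (Ici 0) (x : ℝ) =
      derivWithin (onReal u) (Ici 0) x + derivWithin (onReal v) (Ici 0) x :=
    derivWithin_add (hu.differentiableWithinAt x.2) (hv.differentiableWithinAt x.2)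
  rcases eq_or_lt_of_le x.2 with h0 | h0
  · have h0' : (x : ℝ) = 0 := h0.symm
    simp only [diffExpr, Pi.add_apply, h1]
    simp [h0']
    ring
  · simp only [diffExpr, Pi.add_apply, h1, hu.deriv_deriv_add hv (x := x) h0]
    ring

lemma MemDomain.diffExpr_smul {γ b : ℝ} {u : ℝ≥0 → 𝕜} (hu : MemDomain γ b u) (c : 𝕜) :
    diffExpr γ b (c • u) = c • diffExpr γ b u := by
  funext x
  have h1 : derivWithin (onReal (c • u)) (Ici 0) (x : ℝ) =
      c * derivWithin (onReal u) (Ici 0) x :=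
    derivWithin_const_mul c (hu.differentiableWithinAt x.2)
  rcases eq_or_lt_of_le x.2 with h0 | h0
  · have h0' : (x : ℝ) = 0 := h0.symm
    simp only [diffExpr, Pi.smul_apply, smul_eq_mul, h1]
    simp [h0']
    ring
  · simp only [diffExpr, Pi.smul_apply, smul_eq_mul, h1, hu.deriv_deriv_smul c (x := x) h0]
    ring

lemma memDomain_zero (γ b : ℝ) : MemDomain γ b (0 : ℝ≥0 → 𝕜) := by
  have h0 : onReal (0 : ℝ≥0 → 𝕜) = fun _ => 0 := rfl
  have h1 : deriv (fun _ : ℝ => (0 : 𝕜)) = fun _ => 0 := by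
    funext x
    simp
  refine ⟨?_, ?_, ?_, ?_⟩
  · rw [h0]
    exact contDiffOn_const
  · rw [h0]
    exact contDiffOn_const
  · simp [h0, h1]
  · have : diffExpr γ b (0 : ℝ≥0 → 𝕜) = fun _ => 0 := by
      funext x
      simp [diffExpr, h0, h1]
    rw [this]
    exact tendsto_const_nhds

lemma MemDomain.add {γ b : ℝ} {u v : ℝ≥0 → 𝕜} (hu : MemDomain γ b u) (hv : MemDomain γ b v) :
    MemDomain γ b (u + v) where
  contDiffOn_one := hu.contDiffOn_one.add hv.contDiffOn_one
  contDiffOn_two := hu.contDiffOn_two.add hv.contDiffOn_two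
  tendsto_zero := by
    have h := hu.tendsto_zero.add hv.tendsto_zero
    rw [add_zero] at h
    refine h.congr' ?_
    filter_upwards [self_mem_nhdsWithin] with x hx
    rw [hu.deriv_deriv_add hv hx, mul_add]
  tendsto_atTop := by
    have h := hu.tendsto_atTop.add hv.tendsto_atTop
    rw [add_zero] at h
    rw [hu.diffExpr_add hv]
    exact h

lemma MemDomain.smul {γ b : ℝ} {u : ℝ≥0 → 𝕜} (hu : MemDomain γ b u) (c : 𝕜) :
    MemDomain γ b (c • u) where
  contDiffOn_one := contDiffOn_const.mul hu.contDiffOn_one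
  contDiffOn_two := contDiffOn_const.mul hu.contDiffOn_two
  tendsto_zero := by
    have h := hu.tendsto_zero.const_mul c
    rw [mul_zero] at h
    refine h.congr' ?_
    filter_upwards [self_mem_nhdsWithin] with x hx
    rw [hu.deriv_deriv_smul c hx]
    ring
  tendsto_atTop := by
    have h := hu.tendsto_atTop.const_smul c
    rw [smul_zero] at h
    rw [hu.diffExpr_smul c]
    exact h

lemma MemDomain.continuous_diffExpr {γ b : ℝ} {u : ℝ≥0 → 𝕜} (hu : MemDomain γ b u) :
    Continuous (diffExpr γ b u) := by
  have h1 : ContinuousOn (derivWithin (onReal u) (Ici 0)) (Ici 0) :=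
    hu.contDiffOn_one.continuousOn_derivWithin (uniqueDiffOn_Ici 0) (by norm_num)
  have h2 : ContinuousOn (deriv (deriv (onReal u))) (Ioi 0) :=
    hu.contDiffOn_deriv.continuousOn_deriv_of_isOpen isOpen_Ioi (by norm_num)
  have h3 : ContinuousOn
      (fun x : ℝ => (x : 𝕜) * deriv (deriv (onReal u)) x) (Ici 0) := by
    intro x hx
    rcases eq_or_lt_of_le (mem_Ici.1 hx) with h0 | h0
    · subst h0
      rw [← continuousWithinAt_Ioi_iff_Ici]
      simpa [ContinuousWithinAt] using hu.tendsto_zero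
    · exact ((RCLike.continuous_ofReal.continuousAt).mul
        (h2.continuousAt (Ioi_mem_nhds h0))).continuousWithinAt
  have h4 : ContinuousOn (fun x : ℝ => (γ : 𝕜) * ((x : 𝕜) * deriv (deriv (onReal u)) x) +
      (b : 𝕜) * derivWithin (onReal u) (Ici 0) x) (Ici 0) :=
    (continuousOn_const.mul h3).add (continuousOn_const.mul h1)
  have h5 := h4.comp_continuous NNReal.continuous_coe (fun x : ℝ≥0 => x.2)
  refine h5.congr fun x => ?_
  simp only [diffExpr, Function.comp_apply]
  push_cast
  ring

lemma exists_norm_le_of_tendsto {g : ℝ≥0 → 𝕜} (hg : Continuous g) {l : 𝕜}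
    (hl : Tendsto g atTop (𝓝 l)) : ∃ C, ∀ x, ‖g x‖ ≤ C := by
  have h1 : ∀ᶠ x in atTop, ‖g x‖ < ‖l‖ + 1 := hl.norm.eventually_lt_const (lt_add_one _)
  obtain ⟨M, hM⟩ := eventually_atTop.1 h1
  obtain ⟨C, hC⟩ := (isCompact_Icc (a := (0 : ℝ≥0)) (b := M)).exists_bound_of_continuousOn
    hg.continuousOn
  refine ⟨max C (‖l‖ + 1), fun x => ?_⟩
  rcases le_total x M with h | h
  · exact (hC x ⟨zero_le, h⟩).trans (le_max_left _ _)
  · exact (hM x h).le.trans (le_max_right _ _)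

/-- A continuous function that converges at infinity, as an element of `C([0,∞])`. -/
noncomputable def CInfty.mk (g : ℝ≥0 → 𝕜) (hg : Continuous g)
    (hl : ∃ l : 𝕜, Tendsto g atTop (𝓝 l)) : CInfty 𝕜 :=
  ⟨BoundedContinuousFunction.ofNormedAddCommGroup g hg
    (exists_norm_le_of_tendsto hg hl.choose_spec).choose
    (exists_norm_le_of_tendsto hg hl.choose_spec).choose_spec, hl⟩

/-- The operator `A^{γ,b} u = γ x u'' + b u'` in `C([0,∞])` with domain `D(A^{γ,b})`, for
`γ, b > 0`. -/
noncomputable def operatorA (𝕜 : Type*) [RCLike 𝕜] (γ b : ℝ) : CInfty 𝕜 →ₗ.[𝕜] CInfty 𝕜 where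
  domain :=
    { carrier := {u | MemDomain γ b (u : ℝ≥0 →ᵇ 𝕜)}
      zero_mem' := memDomain_zero γ b
      add_mem' := fun hu hv => MemDomain.add hu hv
      smul_mem' := fun c _ hu => MemDomain.smul hu c }
  toFun :=
    { toFun := fun u => CInfty.mk (diffExpr γ b (u : ℝ≥0 →ᵇ 𝕜))
        (MemDomain.continuous_diffExpr u.2) ⟨0, MemDomain.tendsto_atTop u.2⟩
      map_add' := fun u v => by
        apply Subtype.ext
        ext x
        exact congrFun (MemDomain.diffExpr_add u.2 v.2) x
      map_smul' := fun c u => by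
        apply Subtype.ext
        ext x
        exact congrFun (MemDomain.diffExpr_smul u.2 c) x }

/-- `R` is a bounded two-sided inverse of `z I - A : D(A) → X`, for an operator `A` in `X` with
domain `D(A)`. -/
structure IsResolventAt {X : Type*} [NormedAddCommGroup X] [NormedSpace 𝕜 X]
    (A : X →ₗ.[𝕜] X) (z : 𝕜) (R : X →L[𝕜] X) : Prop where
  mem_domain : ∀ f : X, R f ∈ A.domain
  right_inv : ∀ f : X, z • R f - A ⟨R f, mem_domain f⟩ = f
  left_inv : ∀ u : A.domain, R (z • (u : X) - A u) = u

/-- The resolvent set of `A`. -/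
def resolventSet {X : Type*} [NormedAddCommGroup X] [NormedSpace 𝕜 X] (A : X →ₗ.[𝕜] X) : Set 𝕜 :=
  {z | ∃ R : X →L[𝕜] X, IsResolventAt A z R}

open Classical in
/-- The resolvent `R(z, A) = (z I - A)⁻¹`, for `z` in the resolvent set of `A` (and `0` for other
`z`). -/
noncomputable def resolventOp {X : Type*} [NormedAddCommGroup X] [NormedSpace 𝕜 X]
    (A : X →ₗ.[𝕜] X) (z : 𝕜) : X →L[𝕜] X :=
  if h : z ∈ resolventSet A then Classical.choose h else 0

end DegenerateDiffusion

/-! Put `β = b / γ`. On the half-line, `γ y u'' + b u' = g` is a first-order Euler equation for `V =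
u'`, namely `y V' + β V = g / γ`. Its only solution continuous up to `0` is the average `V(y) = ∫₀¹
t^(β-1) g(y t) / γ dt`. The weight has mass `1 / β = γ / b`, so `b |u'| ≤ ‖g‖`, and then `γ |y u''|
= |g - b u'| ≤ 2 ‖g‖`, with no dependence on `b` (`MemDomain.norm_mul_deriv_deriv_le`). For `u =
R(λ, A) f` one has `A u = λ u - f`, and the maximum principle gives `λ ‖u‖ ≤ ‖f‖`
(`MemDomain.mul_norm_le`). Hence `‖A u‖ ≤ 2 ‖f‖` and `|x u''| ≤ (4 / γ) ‖f‖`.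

The resolvent exists because `λ - A` is bounded below and onto. Its range `N` is closed, since the
averaging formula makes `A` a closed operator (`memDomain_of_tendsto`). For density, let `p(s)` be
the function `exp (-s x)`. Then `(λ - A) p(s) = γ s² p'(s) + (λ + b s) p(s)`, so modulo `N` the
bounded curve `p` solves a homogeneous linear equation whose nonzero solutions `s^(-β) exp (λ / (γ
s)) c` blow up at `s = 0`. Thus every exponential lies in `N` (`mem_of_hasDerivAt_exponential`), and
Bernstein approximation in the variable `exp (-x)` shows that exponentials span a dense subspace
(`eq_top_of_expElem_mem`). -/

namespace DegenerateDiffusion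

variable {𝕜 : Type*} [RCLike 𝕜]

/-! ### Averages and the Euler equation `y V' + β V = G` -/

/-- The weighted average `∫₀¹ t^(β-1) G(y t) dt`.  It solves `y V' + β V = G` on `(0,∞)`. -/
noncomputable def weightedAverage (β : ℝ) (G : ℝ → 𝕜) (y : ℝ) : 𝕜 :=
  ∫ t in (0 : ℝ)..1, t ^ (β - 1) • G (y * t)

lemma intervalIntegrable_rpow_smul {β : ℝ} (hβ : 0 < β) {G : ℝ → 𝕜} (hG : Continuous G)
    (a c : ℝ) :
    IntervalIntegrable (fun t => t ^ (β - 1) • G t) MeasureTheory.volume a c :=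
  (intervalIntegral.intervalIntegrable_rpow' (by linarith)).smul_continuousOn hG.continuousOn

lemma integral_rpow_sub_one {β : ℝ} (hβ : 0 < β) :
    ∫ t in (0 : ℝ)..1, t ^ (β - 1) = 1 / β := by
  rw [integral_rpow (Or.inl (by linarith))]
  simp [Real.zero_rpow hβ.ne']

lemma norm_weightedAverage_le {β : ℝ} (hβ : 0 < β) {G : ℝ → 𝕜} {M : ℝ}
    (hM : ∀ z, ‖G z‖ ≤ M) (y : ℝ) : ‖weightedAverage β G y‖ ≤ M / β := by
  have h := intervalIntegral.norm_integral_le_of_norm_le (μ := MeasureTheory.volume)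
    (f := fun t : ℝ => t ^ (β - 1) • G (y * t)) (g := fun t => t ^ (β - 1) * M) zero_le_one
    (MeasureTheory.ae_of_all _ fun t ht => by
      rw [norm_smul, Real.norm_of_nonneg (Real.rpow_nonneg ht.1.le _)]
      exact mul_le_mul_of_nonneg_left (hM _) (Real.rpow_nonneg ht.1.le _))
    ((intervalIntegral.intervalIntegrable_rpow' (by linarith)).mul_const M)
  refine h.trans_eq ?_
  rw [intervalIntegral.integral_mul_const, integral_rpow_sub_one hβ]
  ring

lemma weightedAverage_sub {β : ℝ} (hβ : 0 < β) {G H : ℝ → 𝕜} (hG : Continuous G)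
    (hH : Continuous H) (y : ℝ) :
    weightedAverage β (fun z => G z - H z) y = weightedAverage β G y - weightedAverage β H y := by
  unfold weightedAverage
  rw [← intervalIntegral.integral_sub
    (intervalIntegrable_rpow_smul hβ (G := fun t => G (y * t)) (by fun_prop) 0 1)
    (intervalIntegrable_rpow_smul hβ (G := fun t => H (y * t)) (by fun_prop) 0 1)]
  simp only [smul_sub]

lemma weightedAverage_zero {β : ℝ} (hβ : 0 < β) (G : ℝ → 𝕜) :
    weightedAverage β G 0 = β⁻¹ • G 0 := by
  simp only [weightedAverage, zero_mul]
  rw [intervalIntegral.integral_smul_const, integral_rpow_sub_one hβ, one_div]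

lemma continuous_weightedAverage {β : ℝ} (hβ : 0 < β) {G : ℝ → 𝕜} (hG : Continuous G) {M : ℝ}
    (hM : ∀ z, ‖G z‖ ≤ M) : Continuous (weightedAverage β G) := by
  refine intervalIntegral.continuous_of_dominated_interval (bound := fun t => t ^ (β - 1) * M)
    (fun y => ?_) (fun y => ?_) ?_ ?_
  · exact (intervalIntegrable_rpow_smul hβ (G := fun t => G (y * t)) (by fun_prop) 0 1).aestronglyMeasurable_restrict_uIoc
  · refine MeasureTheory.ae_of_all _ fun t ht => ?_
    rw [uIoc_of_le zero_le_one] at ht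
    rw [norm_smul, Real.norm_of_nonneg (Real.rpow_nonneg ht.1.le _)]
    exact mul_le_mul_of_nonneg_left (hM _) (Real.rpow_nonneg ht.1.le _)
  · exact (intervalIntegral.intervalIntegrable_rpow' (by linarith)).mul_const M
  · exact MeasureTheory.ae_of_all _ fun t _ => by fun_prop

/-- The substitution `s = y t` moves `y` out of the argument of `G`, so that the average can be
differentiated for merely continuous `G`. -/
lemma weightedAverage_of_pos {β : ℝ} (G : ℝ → 𝕜) {y : ℝ} (hy : 0 < y) :
    weightedAverage β G y = y ^ (-β) • ∫ s in (0 : ℝ)..y, s ^ (β - 1) • G s := by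
  have h1 := intervalIntegral.smul_integral_comp_mul_left (a := 0) (b := 1)
    (fun s : ℝ => s ^ (β - 1) • G s) y
  simp only [mul_zero, mul_one] at h1
  rw [← h1, weightedAverage, ← intervalIntegral.integral_smul, ← intervalIntegral.integral_smul]
  refine intervalIntegral.integral_congr fun t ht => ?_
  rw [uIcc_of_le zero_le_one] at ht
  simp only [smul_smul]
  congr 1
  rw [Real.mul_rpow hy.le ht.1, Real.rpow_sub hy, Real.rpow_neg hy.le, Real.rpow_one]
  have := (Real.rpow_pos_of_pos hy β).ne'
  field_simp

lemma hasDerivAt_weightedAverage {β : ℝ} (hβ : 0 < β) {G : ℝ → 𝕜} (hG : Continuous G) {y : ℝ}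
    (hy : 0 < y) :
    HasDerivAt (weightedAverage β G) (y⁻¹ • (G y - β • weightedAverage β G y)) y := by
  have hc : ContinuousAt (fun s : ℝ => s ^ (β - 1) • G s) y :=
    (Real.continuousAt_rpow_const y _ (Or.inl hy.ne')).smul hG.continuousAt
  have hm : StronglyMeasurableAtFilter (fun s : ℝ => s ^ (β - 1) • G s) (𝓝 y) :=
    ContinuousAt.stronglyMeasurableAtFilter isOpen_Ioi
      (fun x hx => (Real.continuousAt_rpow_const x _ (Or.inl (ne_of_gt hx))).smul hG.continuousAt) y hy
  have h1 := intervalIntegral.integral_hasDerivAt_right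
    (intervalIntegrable_rpow_smul hβ hG 0 y) hm hc
  have h2 := (Real.hasDerivAt_rpow_const (x := y) (p := -β) (Or.inl hy.ne')).smul h1
  have h3 : weightedAverage β G =ᶠ[𝓝 y]
      fun y => y ^ (-β) • ∫ s in (0 : ℝ)..y, s ^ (β - 1) • G s := by
    filter_upwards [Ioi_mem_nhds hy] with z hz using weightedAverage_of_pos G hz
  refine (h2.congr_of_eventuallyEq h3).congr_deriv ?_
  have hA : y ^ (-β) * y ^ (β - 1) = y⁻¹ := by
    rw [← Real.rpow_add hy, ← Real.rpow_neg_one]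
    congr 1
    ring
  have hB : -β * y ^ (-β - 1) = -(y⁻¹ * (β * y ^ (-β))) := by
    rw [Real.rpow_sub hy, Real.rpow_one]
    field_simp
  simp only [weightedAverage_of_pos G hy, smul_smul, smul_sub]
  rw [hA, hB, neg_smul, ← sub_eq_add_neg]

/-- Uniqueness for `y V' + β V = G` among functions continuous up to `0`. -/
lemma eq_weightedAverage {β : ℝ} (hβ : 0 < β) {G V V' : ℝ → 𝕜} (hG : Continuous G) {M : ℝ}
    (hM : ∀ z, ‖G z‖ ≤ M) (hV : ContinuousOn V (Ici 0))
    (hV' : ∀ y, 0 < y → HasDerivAt V (V' y) y)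
    (heq : ∀ y, 0 < y → y • V' y + β • V y = G y) {y : ℝ} (hy : 0 < y) :
    V y = weightedAverage β G y := by
  -- `z ^ β` is the integrating factor: `D` has zero derivative on `(0,∞)` and vanishes at `0`,
  -- because `β > 0` and `V` is continuous there.
  let D : ℝ → 𝕜 := fun z => z ^ β • (V z - weightedAverage β G z)
  have hW := continuous_weightedAverage hβ hG hM
  have hD := intervalIntegral.integral_eq_sub_of_hasDerivAt_of_le (f := D) (f' := fun _ => 0) hy.le
    ((Real.continuous_rpow_const hβ.le).continuousOn.smul
      ((hV.mono Icc_subset_Ici_self).sub hW.continuousOn))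
    (fun z hz => by
      refine ((Real.hasDerivAt_rpow_const (x := z) (p := β) (Or.inl hz.1.ne')).smul
        ((hV' z hz.1).sub (hasDerivAt_weightedAverage hβ hG hz.1))).congr_deriv ?_
      have h1 : V' z = z⁻¹ • (G z - β • V z) := by
        rw [← heq z hz.1, add_sub_cancel_right, inv_smul_smul₀ hz.1.ne']
      simp only [Pi.sub_apply]
      rw [h1, Real.rpow_sub hz.1, Real.rpow_one]
      match_scalars <;> field_simp <;> ring)
    intervalIntegrable_const
  simp only [intervalIntegral.integral_zero, D, Real.zero_rpow hβ.ne', zero_smul, sub_zero] at hD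
  exact sub_eq_zero.1 ((smul_eq_zero.1 hD.symm).resolve_left (Real.rpow_pos_of_pos hy β).ne')

/-! ### Integral representation of the domain and derivative bounds -/

lemma onReal_coe {E : Type*} (u : ℝ≥0 → E) (x : ℝ≥0) : onReal u x = u x := by
  simp [onReal]

lemma continuous_onReal {u : ℝ≥0 → 𝕜} (hu : Continuous u) : Continuous (onReal u) :=
  hu.comp continuous_real_toNNReal

lemma derivWithin_Ici_eq_deriv (f : ℝ → 𝕜) {x : ℝ} (hx : 0 < x) :
    derivWithin f (Ici 0) x = deriv f x :=
  derivWithin_of_mem_nhds (Ici_mem_nhds hx)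

lemma onReal_diffExpr (γ b : ℝ) (u : ℝ≥0 → 𝕜) {x : ℝ} (hx : 0 < x) :
    onReal (diffExpr γ b u) x =
      γ • ((x : 𝕜) * deriv (deriv (onReal u)) x) + b • deriv (onReal u) x := by
  simp only [onReal, diffExpr, Real.coe_toNNReal x hx.le]
  rw [derivWithin_Ici_eq_deriv _ hx, RCLike.real_smul_eq_coe_mul, RCLike.real_smul_eq_coe_mul]
  push_cast
  ring

/-- The derivative of `u ∈ D(A^{γ,b})` is recovered from `A^{γ,b} u` by averaging. -/
lemma MemDomain.deriv_eq_weightedAverage {γ b : ℝ} (hγ : 0 < γ) (hb : 0 < b) {u : ℝ≥0 → 𝕜}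
    (hu : MemDomain γ b u) {M : ℝ} (hM : ∀ x, ‖diffExpr γ b u x‖ ≤ M) {y : ℝ} (hy : 0 < y) :
    deriv (onReal u) y =
      weightedAverage (b / γ) (fun z => γ⁻¹ • onReal (diffExpr γ b u) z) y := by
  rw [← derivWithin_Ici_eq_deriv _ hy]
  refine eq_weightedAverage (G := fun z => γ⁻¹ • onReal (diffExpr γ b u) z)
    (V' := deriv (deriv (onReal u))) (M := γ⁻¹ * M) (by positivity)
    ((continuous_onReal hu.continuous_diffExpr).const_smul _) (fun z => ?_)
    (hu.contDiffOn_one.continuousOn_derivWithin (uniqueDiffOn_Ici 0) (by norm_num))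
    (fun z hz => ?_) (fun z hz => ?_) hy
  · rw [norm_smul, Real.norm_of_nonneg (by positivity)]
    exact mul_le_mul_of_nonneg_left (hM _) (by positivity)
  · refine (hu.differentiableAt_deriv hz).hasDerivAt.congr_of_eventuallyEq ?_
    filter_upwards [Ioi_mem_nhds hz] with w hw using derivWithin_Ici_eq_deriv _ hw
  · rw [onReal_diffExpr γ b u hz, derivWithin_Ici_eq_deriv _ hz, smul_add, smul_smul, smul_smul,
      inv_mul_cancel₀ hγ.ne', one_smul, RCLike.real_smul_eq_coe_mul]
    congr 2
    ring

/-- The mass `γ / b` of the weight cancels the factor `γ⁻¹` and the coefficient `b`, so the bound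
does not degenerate for small or large `b`. -/
lemma MemDomain.norm_deriv_le {γ b : ℝ} (hγ : 0 < γ) (hb : 0 < b) {u : ℝ≥0 → 𝕜}
    (hu : MemDomain γ b u) {M : ℝ} (hM : ∀ x, ‖diffExpr γ b u x‖ ≤ M) {y : ℝ} (hy : 0 < y) :
    b * ‖deriv (onReal u) y‖ ≤ M := by
  rw [hu.deriv_eq_weightedAverage hγ hb hM hy]
  have h := norm_weightedAverage_le (β := b / γ) (M := γ⁻¹ * M)
    (G := fun z => γ⁻¹ • onReal (diffExpr γ b u) z) (by positivity) (fun z => by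
      rw [norm_smul, Real.norm_of_nonneg (by positivity)]
      exact mul_le_mul_of_nonneg_left (hM _) (by positivity)) y
  calc _ ≤ b * (γ⁻¹ * M / (b / γ)) := mul_le_mul_of_nonneg_left h hb.le
    _ = M := by field_simp

lemma MemDomain.norm_mul_deriv_deriv_le {γ b : ℝ} (hγ : 0 < γ) (hb : 0 < b) {u : ℝ≥0 → 𝕜}
    (hu : MemDomain γ b u) {M : ℝ} (hM : ∀ x, ‖diffExpr γ b u x‖ ≤ M) {y : ℝ} (hy : 0 < y) :
    ‖(y : 𝕜) * deriv (deriv (onReal u)) y‖ ≤ 2 * M / γ := by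
  have h1 := hu.norm_deriv_le hγ hb hM hy
  have h2 : ‖onReal (diffExpr γ b u) y‖ ≤ M := hM _
  have h3 : γ • ((y : 𝕜) * deriv (deriv (onReal u)) y) =
      onReal (diffExpr γ b u) y - b • deriv (onReal u) y := by
    rw [onReal_diffExpr γ b u hy, add_sub_cancel_right]
  have h4 := norm_sub_le (onReal (diffExpr γ b u) y) (b • deriv (onReal u) y)
  rw [← h3, norm_smul, norm_smul, Real.norm_of_nonneg hγ.le, Real.norm_of_nonneg hb.le] at h4
  rw [le_div_iff₀ hγ]
  linarith

/-- Expressing `u` through `u 0` and `A u` without derivatives lets the relation pass to uniform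
limits; this is what makes the operator closed. -/
lemma MemDomain.eq_add_integral {γ b : ℝ} (hγ : 0 < γ) (hb : 0 < b) {u : ℝ≥0 → 𝕜}
    (hu : MemDomain γ b u) {M : ℝ} (hM : ∀ x, ‖diffExpr γ b u x‖ ≤ M) (x : ℝ≥0) :
    u x = u 0 + ∫ y in (0 : ℝ)..x,
      weightedAverage (b / γ) (fun z => γ⁻¹ • onReal (diffExpr γ b u) z) y := by
  have hW : Continuous (weightedAverage (b / γ) (fun z => γ⁻¹ • onReal (diffExpr γ b u) z)) :=
    continuous_weightedAverage (M := γ⁻¹ * M) (by positivity)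
      ((continuous_onReal hu.continuous_diffExpr).const_smul _) fun z => by
        rw [norm_smul, Real.norm_of_nonneg (by positivity)]
        exact mul_le_mul_of_nonneg_left (hM _) (by positivity)
  have h := intervalIntegral.integral_eq_sub_of_hasDerivAt_of_le (f := onReal u) x.2
    (hu.contDiffOn_one.continuousOn.mono Icc_subset_Ici_self)
    (fun z hz => by
      have := (hu.differentiableAt hz.1).hasDerivAt
      rwa [hu.deriv_eq_weightedAverage hγ hb hM hz.1] at this)
    (hW.intervalIntegrable _ _)
  have h0 : onReal u 0 = u 0 := onReal_coe u 0
  have hx : onReal u x.1 = u x := onReal_coe u x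
  rw [hx, h0] at h
  exact (add_eq_of_eq_sub' h).symm

/-- Functions given by the integral formula are in the domain. -/
lemma memDomain_of_eq_add_integral {γ b : ℝ} (hγ : 0 < γ) (hb : 0 < b) {u h : ℝ≥0 → 𝕜}
    (hh : Continuous h) {M : ℝ} (hM : ∀ x, ‖h x‖ ≤ M) (hlim : Tendsto h atTop (𝓝 0))
    (hu : ∀ x : ℝ≥0, u x = u 0 + ∫ y in (0 : ℝ)..x,
      weightedAverage (b / γ) (fun z => γ⁻¹ • onReal h z) y) :
    MemDomain γ b u ∧ diffExpr γ b u = h := by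
  set G : ℝ → 𝕜 := fun z => γ⁻¹ • onReal h z with hGdef
  have hβ : 0 < b / γ := by positivity
  have hG : Continuous G := (continuous_onReal hh).const_smul _
  have hGM : ∀ z, ‖G z‖ ≤ γ⁻¹ * M := fun z => by
    rw [hGdef, norm_smul, Real.norm_of_nonneg (by positivity)]
    exact mul_le_mul_of_nonneg_left (hM _) (by positivity)
  set W := weightedAverage (b / γ) G
  have hW : Continuous W := continuous_weightedAverage hβ hG hGM
  let U : ℝ → 𝕜 := fun x => u 0 + ∫ y in (0 : ℝ)..x, W y
  have hU : ∀ x, HasDerivAt U (W x) x := fun x =>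
    (intervalIntegral.integral_hasDerivAt_right (hW.intervalIntegrable _ _)
      hW.measurable.stronglyMeasurable.stronglyMeasurableAtFilter hW.continuousAt).const_add _
  have heq : EqOn (onReal u) U (Ici 0) := fun x hx => by
    have := hu ⟨x, hx⟩
    rwa [← onReal_coe u ⟨x, hx⟩] at this
  have hUC : ContDiff ℝ 1 U := by
    rw [contDiff_one_iff_deriv]
    refine ⟨fun x => (hU x).differentiableAt, ?_⟩
    rwa [show deriv U = W from funext fun x => (hU x).deriv]
  have hd : ∀ x, 0 < x → HasDerivAt (onReal u) (W x) x := fun x hx =>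
    (hU x).congr_of_eventuallyEq <| by
      filter_upwards [Ici_mem_nhds hx] with y hy using heq hy
  have hdd : ∀ x, 0 < x →
      HasDerivAt (deriv (onReal u)) (x⁻¹ • (G x - (b / γ) • W x)) x := fun x hx =>
    (hasDerivAt_weightedAverage hβ hG hx).congr_of_eventuallyEq <| by
      filter_upwards [Ioi_mem_nhds hx] with y hy using (hd y hy).deriv
  have hx2 : ∀ x : ℝ, 0 < x → (x : 𝕜) * deriv (deriv (onReal u)) x = G x - (b / γ) • W x :=
    fun x hx => by
      rw [(hdd x hx).deriv, ← RCLike.real_smul_eq_coe_mul, smul_inv_smul₀ hx.ne']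
  have hw0 : W 0 = (b / γ)⁻¹ • G 0 := weightedAverage_zero hβ G
  have hdiff : diffExpr γ b u = h := by
    funext x
    rcases eq_or_lt_of_le x.2 with h0 | h0
    · obtain rfl : x = 0 := Subtype.ext h0.symm
      have h1 : derivWithin (onReal u) (Ici 0) 0 = W 0 :=
        (((hU 0).hasDerivWithinAt (s := Ici 0)).congr heq (heq (mem_Ici.2 le_rfl))).derivWithin
          (uniqueDiffOn_Ici 0 0 (mem_Ici.2 le_rfl))
      have h2 : onReal h 0 = h 0 := onReal_coe h 0
      simp only [diffExpr, NNReal.coe_zero, mul_zero, RCLike.ofReal_zero, zero_mul, zero_add]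
      rw [h1, hw0, hGdef, ← RCLike.real_smul_eq_coe_mul]
      simp only [smul_smul, h2]
      rw [show b * ((b / γ)⁻¹ * γ⁻¹) = 1 by field_simp, one_smul]
    · have h1 := onReal_diffExpr γ b u (x := x) h0
      rw [hx2 x h0, (hd x h0).deriv, onReal_coe, smul_sub, smul_smul γ (b / γ),
        mul_div_cancel₀ _ hγ.ne', sub_add_cancel, hGdef] at h1
      simpa only [smul_inv_smul₀ hγ.ne', onReal_coe] using h1
  refine ⟨⟨hUC.contDiffOn.congr heq, ?_, ?_, hdiff ▸ hlim⟩, hdiff⟩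
  · rw [show (2 : WithTop ℕ∞) = 1 + 1 by norm_num, contDiffOn_succ_iff_deriv_of_isOpen isOpen_Ioi]
    refine ⟨fun x hx => (hd x hx).differentiableAt.differentiableWithinAt, by simp, ?_⟩
    rw [show (1 : WithTop ℕ∞) = 0 + 1 by norm_num, contDiffOn_succ_iff_deriv_of_isOpen isOpen_Ioi]
    refine ⟨fun x hx => (hdd x hx).differentiableAt.differentiableWithinAt, by simp, ?_⟩
    rw [contDiffOn_zero]
    refine ContinuousOn.congr (f := fun x => x⁻¹ • (G x - (b / γ) • W x)) ?_
      fun x hx => (hdd x hx).deriv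
    exact (continuousOn_inv₀.mono fun x hx => ne_of_gt hx).smul
      (hG.sub (hW.const_smul _)).continuousOn
  -- The value `W 0 = G 0 / β` is exactly what makes `x u'' = G - β W` vanish at `0`.
  · have h1 : Tendsto (fun x => G x - (b / γ) • W x) (𝓝[>] 0) (𝓝 0) := by
      have : Tendsto (fun x => G x - (b / γ) • W x) (𝓝 0) (𝓝 (G 0 - (b / γ) • W 0)) :=
        (hG.sub (hW.const_smul (b / γ))).tendsto 0
      rw [hw0, smul_inv_smul₀ hβ.ne', sub_self] at this
      exact this.mono_left nhdsWithin_le_nhds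
    refine h1.congr' ?_
    filter_upwards [self_mem_nhdsWithin] with x hx using (hx2 x hx).symm

/-! ### Completeness of the space and closedness of the operator -/

lemma isClosed_CInfty : IsClosed (CInfty 𝕜 : Set (ℝ≥0 →ᵇ 𝕜)) := by
  refine isClosed_of_closure_subset fun f hf => ?_
  have : Cauchy (map f atTop) := by
    refine Metric.cauchy_iff.2 ⟨inferInstance, fun ε hε => ?_⟩
    obtain ⟨g, ⟨l, hl⟩, hfg⟩ := Metric.mem_closure_iff.1 hf (ε / 4) (by positivity)
    refine ⟨f '' {x | dist (g x) l < ε / 4},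
      image_mem_map (hl (Metric.ball_mem_nhds l (by positivity))), ?_⟩
    rintro _ ⟨x, hx, rfl⟩ _ ⟨y, hy, rfl⟩
    have h1 := (BoundedContinuousFunction.dist_coe_le_dist (f := f) (g := g) x).trans_lt hfg
    have h2 := (BoundedContinuousFunction.dist_coe_le_dist (f := f) (g := g) y).trans_lt hfg
    have h3 := dist_triangle4 (f x) (g x) (g y) (f y)
    have h4 := dist_triangle_right (g x) (g y) l
    rw [dist_comm (g y) (f y)] at h3
    simp only [mem_ofPred_eq] at hx hy
    linarith
  obtain ⟨l, hl⟩ := cauchy_map_iff_exists_tendsto.1 this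
  exact ⟨l, hl⟩

instance : CompleteSpace (CInfty 𝕜) := isClosed_CInfty.completeSpace_coe

lemma norm_smul_onReal_le {γ : ℝ} (hγ : 0 < γ) (h : ℝ≥0 →ᵇ 𝕜) (z : ℝ) :
    ‖γ⁻¹ • onReal h z‖ ≤ γ⁻¹ * ‖h‖ := by
  rw [norm_smul, Real.norm_of_nonneg (by positivity)]
  exact mul_le_mul_of_nonneg_left (h.norm_coe_le_norm _) (by positivity)

/-- The operator `A^{γ,b}` is closed. -/
lemma memDomain_of_tendsto {γ b : ℝ} (hγ : 0 < γ) (hb : 0 < b) {u h : ℕ → ℝ≥0 →ᵇ 𝕜}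
    {u' h' : ℝ≥0 →ᵇ 𝕜} (hu : ∀ n, MemDomain γ b (u n)) (huh : ∀ n, diffExpr γ b (u n) = h n)
    (hu' : Tendsto u atTop (𝓝 u')) (hh' : Tendsto h atTop (𝓝 h')) :
    MemDomain γ b u' ∧ diffExpr γ b u' = h' := by
  have hβ : 0 < b / γ := by positivity
  have hG : ∀ h : ℝ≥0 →ᵇ 𝕜, Continuous (fun z => γ⁻¹ • onReal h z) := fun h =>
    (continuous_onReal h.continuous).const_smul _
  refine memDomain_of_eq_add_integral hγ hb h'.continuous h'.norm_coe_le_norm ?_ fun x => ?_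
  · rw [Metric.tendsto_nhds]
    intro ε hε
    obtain ⟨n, hn⟩ := (Metric.tendsto_nhds.1 hh' (ε / 2) (by positivity)).exists
    have h1 := (hu n).tendsto_atTop
    rw [huh n, Metric.tendsto_nhds] at h1
    filter_upwards [h1 (ε / 2) (by positivity)] with x hx
    have h2 := (BoundedContinuousFunction.dist_coe_le_dist (f := h n) (g := h') x).trans_lt hn
    have h3 := dist_triangle_left (h' x) 0 (h n x)
    linarith
  · have hux : ∀ x, Tendsto (fun n => u n x) atTop (𝓝 (u' x)) := fun x =>
      (BoundedContinuousFunction.tendsto_iff_tendstoUniformly.1 hu').tendsto_at x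
    have hint : Tendsto (fun n => ∫ y in (0 : ℝ)..x,
        weightedAverage (b / γ) (fun z => γ⁻¹ • onReal (h n) z) y) atTop
        (𝓝 (∫ y in (0 : ℝ)..x, weightedAverage (b / γ) (fun z => γ⁻¹ • onReal h' z) y)) := by
      rw [tendsto_iff_norm_sub_tendsto_zero]
      -- The average is linear in its data with norm at most `1 / β`, so on `[0, x]` the integrals
      -- differ by at most this multiple of `‖h n - h'‖`.
      have h0 : Tendsto (fun n => γ⁻¹ * ‖h n - h'‖ / (b / γ) * |(x : ℝ) - 0|) atTop (𝓝 0) := by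
        have := (((tendsto_iff_norm_sub_tendsto_zero.1 hh').const_mul γ⁻¹).div_const
          (b / γ)).mul_const |(x : ℝ) - 0|
        simpa using this
      refine squeeze_zero (fun n => norm_nonneg _) (fun n => ?_) h0
      have hW : ∀ h : ℝ≥0 →ᵇ 𝕜,
          Continuous (weightedAverage (b / γ) (fun z => γ⁻¹ • onReal h z)) := fun h =>
        continuous_weightedAverage hβ (hG h) (norm_smul_onReal_le hγ h)
      rw [← intervalIntegral.integral_sub ((hW _).intervalIntegrable _ _)
        ((hW _).intervalIntegrable _ _)]
      refine intervalIntegral.norm_integral_le_of_norm_le_const fun y _ => ?_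
      rw [← weightedAverage_sub hβ (hG _) (hG _)]
      refine norm_weightedAverage_le hβ (fun z => ?_) y
      have := norm_smul_onReal_le hγ (h n - h') z
      simpa only [onReal, BoundedContinuousFunction.coe_sub, Pi.sub_apply, smul_sub] using this
    refine tendsto_nhds_unique (hux x) (((hux 0).add hint).congr fun n => ?_)
    rw [← huh n]
    exact ((hu n).eq_add_integral hγ hb (M := ‖h n‖)
      (fun x => by rw [huh n]; exact (h n).norm_coe_le_norm x) x).symm

/-! ### Maximum principle and dissipativity -/

/-- If the second derivative were positive, `x` would also be a local minimum, so `φ` would be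
locally constant with zero second derivative. -/
lemma deriv_deriv_nonpos_of_isLocalMax {φ : ℝ → ℝ} {x : ℝ} (hmax : IsLocalMax φ x)
    (hc : ContinuousAt φ x) : deriv (deriv φ) x ≤ 0 := by
  by_contra! hpos
  have hmin := isLocalMin_of_deriv_deriv_pos hpos hmax.deriv_eq_zero hc
  have hconst : φ =ᶠ[𝓝 x] fun _ => φ x := by
    filter_upwards [hmax, hmin] with y h1 h2 using le_antisymm h1 h2
  have h1 : deriv φ =ᶠ[𝓝 x] fun _ => 0 := by
    simpa using hconst.deriv
  rw [h1.deriv_eq, deriv_const] at hpos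
  exact lt_irrefl 0 hpos

/-- Positive maximum principle for `A^{γ,b}`. -/
lemma MemDomain.apply_diffExpr_nonpos {γ b : ℝ} (hγ : 0 < γ) (hb : 0 < b) {u : ℝ≥0 → 𝕜}
    (hu : MemDomain γ b u) (L : 𝕜 →L[ℝ] ℝ) {x : ℝ≥0} (hx : ∀ y, L (u y) ≤ L (u x)) :
    L (diffExpr γ b u x) ≤ 0 := by
  have hmax : ∀ y : ℝ, L (onReal u y) ≤ L (onReal u x) := fun y => by
    rw [onReal_coe]
    exact hx _
  rcases eq_or_lt_of_le x.2 with h0 | h0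
  · obtain rfl : x = 0 := Subtype.ext h0.symm
    have h1 := L.hasFDerivAt.comp_hasDerivWithinAt (0 : ℝ)
      (hu.differentiableWithinAt le_rfl).hasDerivWithinAt
    have h2 : L (derivWithin (onReal u) (Ici 0) 0) ≤ 0 := by
      refine le_of_tendsto (hasDerivWithinAt_iff_tendsto_slope' (by simp) |>.1
        h1.Ioi_of_Ici) ?_
      filter_upwards [self_mem_nhdsWithin] with y hy
      rw [slope_def_field]
      exact div_nonpos_of_nonpos_of_nonneg (sub_nonpos.2 (hmax y)) (by simpa using (mem_Ioi.1 hy).le)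
    simp only [diffExpr, NNReal.coe_zero, mul_zero, RCLike.ofReal_zero, zero_mul, zero_add]
    rw [← RCLike.real_smul_eq_coe_mul, map_smul]
    exact mul_nonpos_of_nonneg_of_nonpos hb.le h2
  · have hd : ∀ y, 0 < y → HasDerivAt (fun z => L (onReal u z)) (L (deriv (onReal u) y)) y :=
      fun y hy => L.hasFDerivAt.comp_hasDerivAt y (hu.differentiableAt hy).hasDerivAt
    have hdd : HasDerivAt (deriv fun z => L (onReal u z)) (L (deriv (deriv (onReal u)) x)) x :=
      (L.hasFDerivAt.comp_hasDerivAt (x : ℝ)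
        (hu.differentiableAt_deriv h0).hasDerivAt).congr_of_eventuallyEq <| by
          filter_upwards [Ioi_mem_nhds h0] with y hy using (hd y hy).deriv
    have hloc : IsLocalMax (fun z => L (onReal u z)) x := Eventually.of_forall hmax
    have h1 := hloc.hasDerivAt_eq_zero (hd x h0)
    have h2 := deriv_deriv_nonpos_of_isLocalMax hloc (hd x h0).continuousAt
    rw [hdd.deriv] at h2
    have h3 := onReal_diffExpr γ b u (x := x) h0
    rw [onReal_coe, ← RCLike.real_smul_eq_coe_mul] at h3
    rw [h3, map_add, map_smul, map_smul, map_smul, h1, smul_zero, add_zero]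
    exact mul_nonpos_of_nonneg_of_nonpos hγ.le (mul_nonpos_of_nonneg_of_nonpos x.2 h2)

/-- Dissipativity of `A^{γ,b}`. -/
lemma MemDomain.mul_norm_le {γ b : ℝ} (hγ : 0 < γ) (hb : 0 < b) {u : CInfty 𝕜}
    (hu : MemDomain γ b (u : ℝ≥0 →ᵇ 𝕜)) {lam : ℝ} (hlam : 0 < lam) {M : ℝ} (hM0 : 0 ≤ M)
    (hM : ∀ x, ‖lam • (u : ℝ≥0 →ᵇ 𝕜) x - diffExpr γ b (u : ℝ≥0 →ᵇ 𝕜) x‖ ≤ M) :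
    lam * ‖u‖ ≤ M := by
  obtain ⟨v, l, hl⟩ := u
  change lam * ‖v‖ ≤ M
  change MemDomain γ b v at hu
  change ∀ x, ‖lam • v x - diffExpr γ b v x‖ ≤ M at hM
  rw [← le_div_iff₀' hlam, BoundedContinuousFunction.norm_le (by positivity)]
  by_contra! hex
  obtain ⟨x₁, hx₁⟩ := hex
  -- At infinity `A u → 0`, so the hypothesis itself bounds the limit. A value above `M / lam`
  -- therefore forces the maximum of `‖v‖` to be attained at a finite point.
  have hl' : ‖l‖ ≤ M / lam := by
    have h1 := ((hl.const_smul lam).sub hu.tendsto_atTop).norm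
    have h2 := le_of_tendsto h1 (Eventually.of_forall hM)
    rw [sub_zero, norm_smul, Real.norm_of_nonneg hlam.le] at h2
    rwa [le_div_iff₀' hlam]
  obtain ⟨x₀, hx₀⟩ := v.continuous.norm.exists_forall_ge' x₁ (by
    rw [cocompact_eq_atTop]
    filter_upwards [hl.norm.eventually_lt_const (hl'.trans_lt hx₁)] with x hx using hx.le)
  have hpos : M / lam < ‖v x₀‖ := hx₁.trans_le (hx₀ x₁)
  have hv0 : 0 < ‖v x₀‖ := lt_of_le_of_lt (by positivity) hpos
  -- The unimodular `c` rotates `v x₀` onto the positive axis; the real functional `L z = re (c z)`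
  -- then attains its maximum along `v` at `x₀`.
  set c : 𝕜 := (starRingEnd 𝕜) (v x₀) / (‖v x₀‖ : 𝕜) with hc
  have hcn : ‖c‖ = 1 := by
    rw [hc, norm_div, RCLike.norm_conj, RCLike.norm_ofReal, abs_of_pos hv0, div_self hv0.ne']
  have hcv : c * v x₀ = (‖v x₀‖ : 𝕜) := by
    have : (‖v x₀‖ : 𝕜) ≠ 0 := RCLike.ofReal_ne_zero.2 hv0.ne'
    rw [hc, div_mul_eq_mul_div, RCLike.conj_mul]
    field_simp
  let L : 𝕜 →L[ℝ] ℝ := RCLike.reCLM.comp (ContinuousLinearMap.mul ℝ 𝕜 c)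
  have hL : ∀ z, L z ≤ ‖z‖ := fun z => by
    refine (RCLike.re_le_norm (c * z)).trans_eq ?_
    rw [norm_mul, hcn, one_mul]
  have hLv : L (v x₀) = ‖v x₀‖ := by
    change RCLike.re (c * v x₀) = _
    rw [hcv, RCLike.ofReal_re]
  have h1 := hu.apply_diffExpr_nonpos hγ hb L (x := x₀) fun y =>
    (hL _).trans ((hx₀ y).trans_eq hLv.symm)
  have h2 := (hL _).trans (hM x₀)
  rw [map_sub, map_smul, hLv, smul_eq_mul] at h2
  rw [div_lt_iff₀' hlam] at hpos
  linarith

/-! ### The curve of exponentials in `C([0,∞])` -/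

lemma tendsto_exp_neg_mul {s : ℝ} (hs : 0 < s) :
    Tendsto (fun x : ℝ≥0 => Real.exp (-(s * x))) atTop (𝓝 0) :=
  Real.tendsto_exp_neg_atTop_nhds_zero.comp
    (NNReal.tendsto_coe_atTop.2 tendsto_id |>.const_mul_atTop hs)

lemma tendsto_mul_exp_neg_mul {s : ℝ} (hs : 0 < s) :
    Tendsto (fun x : ℝ≥0 => (x : ℝ) * Real.exp (-(s * x))) atTop (𝓝 0) := by
  have h := ((Real.tendsto_pow_mul_exp_neg_atTop_nhds_zero 1).comp
    (NNReal.tendsto_coe_atTop.2 tendsto_id |>.const_mul_atTop hs)).const_mul s⁻¹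
  rw [mul_zero] at h
  refine h.congr fun x => ?_
  simp only [Function.comp_apply, id, pow_one]
  field_simp

/-- The function `x ↦ exp (-s x)` in `C([0,∞])`, for `s ≥ 0`. -/
noncomputable def expElem (𝕜 : Type*) [RCLike 𝕜] (s : ℝ) : CInfty 𝕜 :=
  -- Truncating at `max s 0` makes the curve defined for every real `s`, as needed to differentiate
  -- it in `s`.
  CInfty.mk (fun x => ((Real.exp (-(max s 0 * x)) : ℝ) : 𝕜)) (by fun_prop) <| by
    rcases eq_or_lt_of_le (le_max_right s 0) with h | h
    · exact ⟨1, by simp [← h]⟩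
    · exact ⟨_, (RCLike.continuous_ofReal.tendsto _).comp (tendsto_exp_neg_mul h)⟩

/-- The function `x ↦ x exp (-s x)` in `C([0,∞])`, for `s > 0`. -/
noncomputable def mulExpElem (𝕜 : Type*) [RCLike 𝕜] (s : ℝ) (hs : 0 < s) : CInfty 𝕜 :=
  CInfty.mk (fun x => ((x * Real.exp (-(s * x)) : ℝ) : 𝕜)) (by fun_prop)
    ⟨_, (RCLike.continuous_ofReal.tendsto _).comp (tendsto_mul_exp_neg_mul hs)⟩

lemma expElem_apply {s : ℝ} (hs : 0 ≤ s) (x : ℝ≥0) :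
    (expElem 𝕜 s : ℝ≥0 →ᵇ 𝕜) x = ((Real.exp (-(s * x)) : ℝ) : 𝕜) := by
  change ((Real.exp (-(max s 0 * x)) : ℝ) : 𝕜) = _
  rw [max_eq_left hs]

lemma mulExpElem_apply {s : ℝ} (hs : 0 < s) (x : ℝ≥0) :
    (mulExpElem 𝕜 s hs : ℝ≥0 →ᵇ 𝕜) x = ((x * Real.exp (-(s * x)) : ℝ) : 𝕜) := rfl

lemma norm_expElem_le (s : ℝ) : ‖expElem 𝕜 s‖ ≤ 1 := by
  change ‖(expElem 𝕜 s : ℝ≥0 →ᵇ 𝕜)‖ ≤ 1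
  refine (BoundedContinuousFunction.norm_le zero_le_one).2 fun x => ?_
  change ‖((Real.exp (-(max s 0 * x)) : ℝ) : 𝕜)‖ ≤ 1
  rw [RCLike.norm_ofReal, abs_of_pos (Real.exp_pos _), Real.exp_le_one_iff]
  have : 0 ≤ max s 0 * (x : ℝ) := mul_nonneg (le_max_right _ _) x.2
  linarith

lemma abs_exp_sub_one_sub_le (t : ℝ) : |Real.exp t - 1 - t| ≤ t ^ 2 * Real.exp |t| := by
  have h := Complex.norm_exp_sub_sum_le_norm_mul_exp (t : ℂ) 2
  simp only [Finset.sum_range_succ, Finset.sum_range_zero, Nat.factorial, pow_zero, pow_one,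
    Nat.cast_one, div_one, zero_add, mul_one, Complex.norm_real, Real.norm_eq_abs, sq_abs] at h
  rwa [← sub_sub, ← Complex.ofReal_exp, ← Complex.ofReal_one, ← Complex.ofReal_sub,
    ← Complex.ofReal_sub, Complex.norm_real, Real.norm_eq_abs] at h

/-- A second-order Taylor remainder, uniform in `x`. Half of the decay of `exp (-s x)` absorbs `exp
|h x|`, as `|h| ≤ s / 2`; the other half absorbs `x ^ 2` through `(s x / 2) ^ 2 / 2 ≤ exp (s x /
2)`, whence the `8 / s ^ 2`. -/
lemma abs_exp_add_sub_le {s h x : ℝ} (hs : 0 < s) (hh : |h| ≤ s / 2) (hx : 0 ≤ x) :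
    |Real.exp (-((s + h) * x)) - Real.exp (-(s * x)) + h * (x * Real.exp (-(s * x)))| ≤
      8 / s ^ 2 * h ^ 2 := by
  have h1 := abs_exp_sub_one_sub_le (-(h * x))
  have h2 := Real.pow_div_factorial_le_exp (x := s * x / 2) (by positivity) 2
  have h3 : |-(h * x)| ≤ s * x / 2 := by
    rw [abs_neg, abs_mul, abs_of_nonneg hx]
    nlinarith
  have h4 : Real.exp (-((s + h) * x)) - Real.exp (-(s * x)) + h * (x * Real.exp (-(s * x))) =
      Real.exp (-(s * x)) * (Real.exp (-(h * x)) - 1 - -(h * x)) := by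
    rw [show -((s + h) * x) = -(s * x) + -(h * x) by ring, Real.exp_add]
    ring
  have h5 : Real.exp (-(s * x)) * Real.exp (s * x / 2) * Real.exp (s * x / 2) = 1 := by
    rw [← Real.exp_add, ← Real.exp_add, Real.exp_eq_one_iff]
    ring
  have h6 : x ^ 2 ≤ 8 / s ^ 2 * Real.exp (s * x / 2) := by
    rw [div_mul_eq_mul_div, le_div_iff₀ (by positivity)]
    norm_num [Nat.factorial] at h2
    nlinarith
  rw [h4, abs_mul, abs_of_pos (Real.exp_pos _)]
  calc _ ≤ Real.exp (-(s * x)) * ((-(h * x)) ^ 2 * Real.exp (s * x / 2)) := by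
        gcongr
        refine h1.trans ?_
        gcongr
    _ = h ^ 2 * (Real.exp (-(s * x)) * Real.exp (s * x / 2)) * x ^ 2 := by ring
    _ ≤ h ^ 2 * (Real.exp (-(s * x)) * Real.exp (s * x / 2)) *
        (8 / s ^ 2 * Real.exp (s * x / 2)) := by gcongr
    _ = 8 / s ^ 2 * h ^ 2 * (Real.exp (-(s * x)) * Real.exp (s * x / 2) *
        Real.exp (s * x / 2)) := by ring
    _ = _ := by rw [h5, mul_one]

lemma hasDerivAt_expElem {s : ℝ} (hs : 0 < s) :
    HasDerivAt (expElem 𝕜) (-mulExpElem 𝕜 s hs) s := by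
  rw [hasDerivAt_iff_isLittleO_nhds_zero]
  refine Asymptotics.IsBigO.trans_isLittleO (g := fun h : ℝ => h ^ 2) ?_
    (Asymptotics.isLittleO_pow_id one_lt_two)
  refine Asymptotics.IsBigO.of_bound (8 / s ^ 2) ?_
  filter_upwards [Metric.closedBall_mem_nhds (0 : ℝ) (half_pos hs)] with h hh
  rw [mem_closedBall_zero_iff, Real.norm_eq_abs] at hh
  have hsh : 0 ≤ s + h := by linarith [(abs_le.1 hh).1]
  rw [Real.norm_of_nonneg (sq_nonneg h), smul_neg, sub_neg_eq_add]
  change ‖(expElem 𝕜 (s + h) - expElem 𝕜 s + h • mulExpElem 𝕜 s hs : ℝ≥0 →ᵇ 𝕜)‖ ≤ _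
  refine (BoundedContinuousFunction.norm_le (by positivity)).2 fun x => ?_
  simp only [BoundedContinuousFunction.coe_add, BoundedContinuousFunction.coe_sub, Pi.add_apply,
    Pi.sub_apply, BoundedContinuousFunction.coe_smul, expElem_apply hsh, expElem_apply hs.le,
    mulExpElem_apply]
  refine le_of_eq_of_le ?_ (abs_exp_add_sub_le hs hh x.2)
  rw [← RCLike.norm_ofReal (K := 𝕜), RCLike.real_smul_eq_coe_mul]
  push_cast
  rfl

/-- On exponentials, multiplication by `x` is `-d/ds`, so `A` becomes a first-order differential
operator in the parameter `s`. -/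
lemma memDomain_expElem (γ b : ℝ) {s : ℝ} (hs : 0 ≤ s) :
    MemDomain γ b (expElem 𝕜 s : ℝ≥0 →ᵇ 𝕜) ∧
      ∀ x : ℝ≥0, diffExpr γ b (expElem 𝕜 s : ℝ≥0 →ᵇ 𝕜) x =
        ((γ * s ^ 2 * (x * Real.exp (-(s * x))) - b * s * Real.exp (-(s * x)) : ℝ) : 𝕜) := by
  set u : ℝ≥0 →ᵇ 𝕜 := (expElem 𝕜 s : CInfty 𝕜).1 with hu
  let U : ℝ → 𝕜 := fun x => ((Real.exp (-(s * x)) : ℝ) : 𝕜)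
  have hreal : ∀ x, HasDerivAt (fun x => Real.exp (-(s * x))) (-s * Real.exp (-(s * x))) x :=
    fun x => by
      refine ((hasDerivAt_id x).const_mul s).neg.exp.congr_deriv ?_
      simp only [Pi.neg_apply, id]
      ring
  have hU : ∀ x, HasDerivAt U (((-s * Real.exp (-(s * x)) : ℝ)) : 𝕜) x := fun x =>
    (RCLike.ofRealCLM (K := 𝕜)).hasFDerivAt.comp_hasDerivAt x (hreal x)
  have heq : EqOn (onReal u) U (Ici 0) := fun x hx => by
    simp only [onReal, hu, expElem_apply hs, U]
    rw [Real.coe_toNNReal x hx]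
  have hUC : ContDiff ℝ 2 U := by
    refine (RCLike.ofRealCLM (K := 𝕜)).contDiff.comp (f := fun x => Real.exp (-(s * x))) ?_
    fun_prop
  have hd : ∀ x, 0 < x → HasDerivAt (onReal u) (((-s * Real.exp (-(s * x)) : ℝ)) : 𝕜) x :=
    fun x hx => (hU x).congr_of_eventuallyEq <| by
      filter_upwards [Ici_mem_nhds hx] with y hy using heq hy
  have hdd : ∀ x, 0 < x →
      HasDerivAt (deriv (onReal u)) (((-s * (-s * Real.exp (-(s * x))) : ℝ)) : 𝕜) x := fun x hx =>
    ((RCLike.ofRealCLM (K := 𝕜)).hasFDerivAt.comp_hasDerivAt x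
      ((hreal x).const_mul (-s))).congr_of_eventuallyEq <| by
      filter_upwards [Ioi_mem_nhds hx] with y hy using (hd y hy).deriv
  have hdw : ∀ x : ℝ, 0 ≤ x →
      derivWithin (onReal u) (Ici 0) x = (((-s * Real.exp (-(s * x)) : ℝ)) : 𝕜) := fun x hx =>
    (((hU x).hasDerivWithinAt (s := Ici 0)).congr heq (heq hx)).derivWithin
      (uniqueDiffOn_Ici 0 x hx)
  have hdiff : ∀ x : ℝ≥0, diffExpr γ b u x =
      ((γ * s ^ 2 * (x * Real.exp (-(s * x))) - b * s * Real.exp (-(s * x)) : ℝ) : 𝕜) := fun x => by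
    rw [diffExpr, hdw x x.2]
    rcases eq_or_lt_of_le x.2 with h0 | h0
    · obtain rfl : x = 0 := Subtype.ext h0.symm
      simp
    · rw [(hdd x h0).deriv]
      push_cast
      ring
  refine ⟨⟨(hUC.of_le (by norm_num)).contDiffOn.congr heq,
    hUC.contDiffOn.congr (heq.mono Ioi_subset_Ici_self), ?_, ?_⟩, hdiff⟩
  · have h1 : Continuous fun x : ℝ =>
        (x : 𝕜) * (((-s * (-s * Real.exp (-(s * x))) : ℝ)) : 𝕜) := by fun_prop
    have h2 := h1.tendsto 0
    rw [RCLike.ofReal_zero, zero_mul] at h2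
    refine (h2.mono_left nhdsWithin_le_nhds).congr' ?_
    filter_upwards [self_mem_nhdsWithin] with x hx
    rw [(hdd x hx).deriv]
  · rw [funext hdiff, ← RCLike.ofReal_zero]
    refine (RCLike.continuous_ofReal.tendsto _).comp ?_
    rcases eq_or_lt_of_le hs with rfl | hs
    · simp
    · simpa using ((tendsto_mul_exp_neg_mul hs).const_mul (γ * s ^ 2)).sub
        ((tendsto_exp_neg_mul hs).const_mul (b * s))

/-! ### Density of the exponentials -/

/-- The variable `t = exp (-x)` turns `[0,∞]` into `[0,1]`, with the limit `l` at infinity becoming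
the value at `t = 0`. -/
lemma continuous_comp_neg_log {f : ℝ≥0 → 𝕜} (hf : Continuous f) {l : 𝕜}
    (hl : Tendsto f atTop (𝓝 l)) :
    Continuous fun t : ℝ => if t ≤ 0 then l else f (-Real.log t).toNNReal := by
  rw [continuous_iff_continuousAt]
  intro t
  rcases lt_trichotomy t 0 with ht | rfl | ht
  · refine (continuousAt_const (y := l)).congr ?_
    filter_upwards [Iio_mem_nhds ht] with y hy
    rw [if_pos (le_of_lt hy)]
  · rw [continuousAt_iff_continuous_left'_right']
    constructor
    · refine (continuousWithinAt_const (b := l)).congr (fun y hy => ?_) ?_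
      · rw [if_pos (le_of_lt hy)]
      · rw [if_pos le_rfl]
    · rw [ContinuousWithinAt, if_pos le_rfl]
      refine (hl.comp (tendsto_real_toNNReal_atTop.comp
        (tendsto_neg_atBot_atTop.comp Real.tendsto_log_nhdsGT_zero))).congr' ?_
      filter_upwards [self_mem_nhdsWithin] with y hy
      rw [if_neg (not_le.2 hy)]
      rfl
  · have h1 : ContinuousAt (fun t => f (-Real.log t).toNNReal) t :=
      hf.continuousAt.comp (continuous_real_toNNReal.continuousAt.comp
        (Real.continuousAt_log ht.ne').neg)
    refine h1.congr ?_
    filter_upwards [Ioi_mem_nhds ht] with y hy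
    rw [if_neg (not_le.2 hy)]

/-- With `t = exp (-x)` these are the Bernstein monomials. The induction uses `t^k (1-t)^(m+1) = t^k
(1-t)^m - t^(k+1) (1-t)^m`. -/
lemma exists_mem_eq_exp_pow_mul {N : Submodule 𝕜 (CInfty 𝕜)} (hN : ∀ k : ℕ, expElem 𝕜 k ∈ N)
    (m k : ℕ) : ∃ g ∈ N, ∀ x : ℝ≥0, (g : ℝ≥0 →ᵇ 𝕜) x =
      ((Real.exp (-x) ^ k * (1 - Real.exp (-x)) ^ m : ℝ) : 𝕜) := by
  induction m generalizing k with
  | zero =>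
    refine ⟨_, hN k, fun x => ?_⟩
    rw [expElem_apply (Nat.cast_nonneg k), ← Real.exp_nat_mul]
    simp
  | succ m ih =>
    obtain ⟨g, hg, hg'⟩ := ih k
    obtain ⟨h, hh, hh'⟩ := ih (k + 1)
    refine ⟨g - h, N.sub_mem hg hh, fun x => ?_⟩
    change (g : ℝ≥0 →ᵇ 𝕜) x - (h : ℝ≥0 →ᵇ 𝕜) x = _
    rw [hg', hh']
    push_cast
    ring

/-- The exponentials `x ↦ exp (-k x)`, `k ∈ ℕ`, span a dense subspace of `C([0,∞])`. -/
lemma eq_top_of_expElem_mem {N : Submodule 𝕜 (CInfty 𝕜)} (hcl : IsClosed (N : Set (CInfty 𝕜)))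
    (hN : ∀ k : ℕ, expElem 𝕜 k ∈ N) : N = ⊤ := by
  refine (Submodule.eq_top_iff').2 fun f => ?_
  obtain ⟨l, hl⟩ := f.2
  let F : C(unitInterval, 𝕜) :=
    ⟨fun t => if (t : ℝ) ≤ 0 then l else (f : ℝ≥0 →ᵇ 𝕜) (-Real.log t).toNNReal,
      (continuous_comp_neg_log (f : ℝ≥0 →ᵇ 𝕜).continuous hl).comp continuous_subtype_val⟩
  let τ : ℝ≥0 → unitInterval := fun x =>
    ⟨Real.exp (-x), (Real.exp_pos _).le, Real.exp_le_one_iff.2 (neg_nonpos.2 x.2)⟩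
  have hF : ∀ x, F (τ x) = (f : ℝ≥0 →ᵇ 𝕜) x := fun x => by
    change (if Real.exp (-x) ≤ 0 then l else
      (f : ℝ≥0 →ᵇ 𝕜) (-Real.log (Real.exp (-x))).toNNReal) = _
    rw [if_neg (not_le.2 (Real.exp_pos _)), Real.log_exp, neg_neg, Real.toNNReal_coe]
  refine hcl.closure_subset (Metric.mem_closure_iff.2 fun ε hε => ?_)
  obtain ⟨n, hn⟩ := (Metric.tendsto_nhds.1 (bernsteinApproximation_uniform F) (ε / 2)
    (by positivity)).exists
  choose g hg hg' using exists_mem_eq_exp_pow_mul hN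
  let G : CInfty 𝕜 := ∑ k : Fin (n + 1),
    ((n.choose k : 𝕜) * F (bernstein.z k)) • g (n - k) k
  have hG : ∀ x, (G : ℝ≥0 →ᵇ 𝕜) x = bernsteinApproximation n F (τ x) := fun x => by
    rw [bernsteinApproximation.apply]
    simp only [G, Submodule.coe_sum, BoundedContinuousFunction.coe_sum, Finset.sum_apply]
    refine Finset.sum_congr rfl fun k _ => ?_
    rw [Submodule.coe_smul, BoundedContinuousFunction.coe_smul]
    beta_reduce
    rw [hg', bernstein_apply, RCLike.real_smul_eq_coe_mul, smul_eq_mul]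
    simp only [τ]
    push_cast
    ring
  refine ⟨G, N.sum_mem fun k _ => N.smul_mem _ (hg _ _), ?_⟩
  change dist (f : ℝ≥0 →ᵇ 𝕜) (G : ℝ≥0 →ᵇ 𝕜) < ε
  refine lt_of_le_of_lt ((BoundedContinuousFunction.dist_le (half_pos hε).le).2 fun x => ?_)
    (half_lt_self hε)
  rw [hG, ← hF, dist_comm]
  exact (ContinuousMap.dist_apply_le_dist _).trans hn.le

/-! ### Surjectivity of `λ I - A` -/

/-- The operator `λ I - A^{γ,b}` on its domain. -/
noncomputable def shiftedOperator (𝕜 : Type*) [RCLike 𝕜] (γ b lam : ℝ) :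
    (operatorA 𝕜 γ b).domain →ₗ[𝕜] CInfty 𝕜 :=
  (lam : 𝕜) • (operatorA 𝕜 γ b).domain.subtype - (operatorA 𝕜 γ b).toFun

lemma shiftedOperator_apply {γ b lam : ℝ} (u : (operatorA 𝕜 γ b).domain) (x : ℝ≥0) :
    (shiftedOperator 𝕜 γ b lam u : ℝ≥0 →ᵇ 𝕜) x =
      lam • ((u : CInfty 𝕜) : ℝ≥0 →ᵇ 𝕜) x - diffExpr γ b ((u : CInfty 𝕜) : ℝ≥0 →ᵇ 𝕜) x := by
  rw [RCLike.real_smul_eq_coe_mul]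
  rfl

lemma mul_norm_le_norm_shiftedOperator {γ b lam : ℝ} (hγ : 0 < γ) (hb : 0 < b) (hlam : 0 < lam)
    (u : (operatorA 𝕜 γ b).domain) :
    lam * ‖(u : CInfty 𝕜)‖ ≤ ‖shiftedOperator 𝕜 γ b lam u‖ :=
  MemDomain.mul_norm_le hγ hb u.2 hlam (norm_nonneg _) fun x => by
    rw [← shiftedOperator_apply]
    exact (shiftedOperator 𝕜 γ b lam u : ℝ≥0 →ᵇ 𝕜).norm_coe_le_norm x

/-- Dissipativity makes preimages of a convergent sequence Cauchy; completeness supplies their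
limit, and closedness of `A` puts it in the domain. -/
lemma isClosed_range_shiftedOperator {γ b lam : ℝ} (hγ : 0 < γ) (hb : 0 < b) (hlam : 0 < lam) :
    IsClosed (LinearMap.range (shiftedOperator 𝕜 γ b lam) : Set (CInfty 𝕜)) := by
  refine IsSeqClosed.isClosed fun f f' hf hf' => ?_
  choose u hu using hf
  have hcauchy : CauchySeq fun n => (u n : CInfty 𝕜) := by
    refine Metric.cauchySeq_iff.2 fun ε hε => ?_
    obtain ⟨N, hN⟩ := Metric.cauchySeq_iff.1 hf'.cauchySeq (lam * ε) (by positivity)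
    refine ⟨N, fun m hm n hn => ?_⟩
    have h1 := hN m hm n hn
    have h2 := mul_norm_le_norm_shiftedOperator hγ hb hlam (u m - u n)
    have h3 : shiftedOperator 𝕜 γ b lam (u m - u n) = f m - f n := by
      rw [← hu, ← hu]
      exact (shiftedOperator 𝕜 γ b lam).map_sub (u m) (u n)
    rw [h3, ← dist_eq_norm] at h2
    rw [dist_eq_norm]
    exact lt_of_mul_lt_mul_left (h2.trans_lt h1) hlam.le
  obtain ⟨u', hu'⟩ := cauchySeq_tendsto_of_complete hcauchy
  have hu'' : Tendsto (fun n => ((u n : CInfty 𝕜) : ℝ≥0 →ᵇ 𝕜)) atTop (𝓝 (u' : ℝ≥0 →ᵇ 𝕜)) :=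
    (continuous_subtype_val.tendsto u').comp hu'
  have hf'' : Tendsto (fun n => (f n : ℝ≥0 →ᵇ 𝕜)) atTop (𝓝 (f' : ℝ≥0 →ᵇ 𝕜)) :=
    (continuous_subtype_val.tendsto f').comp hf'
  obtain ⟨h1, h2⟩ := memDomain_of_tendsto hγ hb (fun n => (u n).2)
    (h := fun n => lam • ((u n : CInfty 𝕜) : ℝ≥0 →ᵇ 𝕜) - (f n : ℝ≥0 →ᵇ 𝕜)) (fun n => by
      funext x
      have := shiftedOperator_apply (lam := lam) (u n) x
      rw [hu n] at this
      change _ = lam • ((u n : CInfty 𝕜) : ℝ≥0 →ᵇ 𝕜) x - (f n : ℝ≥0 →ᵇ 𝕜) x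
      rw [this, sub_sub_cancel])
    hu'' ((hu''.const_smul lam).sub hf'')
  refine ⟨⟨u', h1⟩, Subtype.ext (BoundedContinuousFunction.ext fun x => ?_)⟩
  rw [shiftedOperator_apply]
  change lam • (u' : ℝ≥0 →ᵇ 𝕜) x - diffExpr γ b (u' : ℝ≥0 →ᵇ 𝕜) x = _
  rw [h2]
  exact sub_sub_cancel _ _

/-- A bounded solution of `γ s² p' + (λ + b s) p = 0` on `(0,∞)` vanishes. -/
lemma eq_zero_of_hasDerivAt_exponential {E : Type*} [NormedAddCommGroup E] [NormedSpace ℝ E]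
    {γ b lam M : ℝ} (hγ : 0 < γ) (hb : 0 < b) (hlam : 0 < lam) {p p' : ℝ → E}
    (hp : ∀ s, 0 < s → HasDerivAt p (p' s) s)
    (heq : ∀ s, 0 < s → (γ * s ^ 2) • p' s + (lam + b * s) • p s = 0)
    (hM : ∀ s, 0 < s → ‖p s‖ ≤ M) {s : ℝ} (hs : 0 < s) : p s = 0 := by
  have hβ : 0 < b / γ := by positivity
  -- The integrating factor: `w • p` is constant on `(0,∞)`. Since `w r ≤ r ^ (b / γ)` and `p` is
  -- bounded, letting `r → 0⁺` shows that the constant is `0`.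
  let w : ℝ → ℝ := fun s => s ^ (b / γ) * Real.exp (-(lam / γ) * s⁻¹)
  have hwpos : ∀ s, 0 < s → 0 < w s := fun s hs =>
    mul_pos (Real.rpow_pos_of_pos hs _) (Real.exp_pos _)
  have hw : ∀ s, 0 < s → HasDerivAt w (w s * ((lam + b * s) / (γ * s ^ 2))) s := fun s hs => by
    refine ((Real.hasDerivAt_rpow_const (x := s) (p := b / γ) (Or.inl hs.ne')).mul
      ((hasDerivAt_inv hs.ne').const_mul (-(lam / γ))).exp).congr_deriv ?_
    rw [Real.rpow_sub hs, Real.rpow_one]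
    simp only [w]
    field_simp
    ring
  have hp' : ∀ s, 0 < s → p' s = -((lam + b * s) / (γ * s ^ 2)) • p s := fun s hs => by
    have h0 : γ * s ^ 2 ≠ 0 := by positivity
    rw [neg_smul, div_eq_inv_mul, mul_smul, ← smul_neg, ← eq_neg_of_add_eq_zero_left (heq s hs),
      inv_smul_smul₀ h0]
  have hq : ∀ s, 0 < s → HasDerivAt (fun s => w s • p s) 0 s := fun s hs => by
    refine ((hw s hs).smul (hp s hs)).congr_deriv ?_
    rw [hp' s hs]
    module
  have hconst : ∀ r, 0 < r → w r • p r = w s • p s := fun r hr =>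
    (convex_Ioi (0 : ℝ)).is_const_of_fderivWithin_eq_zero (𝕜 := ℝ) (f := fun s => w s • p s)
      (fun t ht => (hq t ht).differentiableAt.differentiableWithinAt)
      (fun t ht => by
        rw [fderivWithin_of_isOpen isOpen_Ioi ht]
        ext
        simpa using (hq t ht).deriv) hr hs
  have hlim : Tendsto (fun r => r ^ (b / γ) * M) (𝓝[>] 0) (𝓝 0) := by
    have h := ((Real.continuous_rpow_const hβ.le).mul_const M).tendsto 0
    simp only [Real.zero_rpow hβ.ne', zero_mul] at h
    exact h.mono_left nhdsWithin_le_nhds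
  have hle : ‖w s • p s‖ ≤ 0 := by
    refine ge_of_tendsto hlim ?_
    filter_upwards [self_mem_nhdsWithin] with r hr
    have hr0 : 0 < r := hr
    rw [← hconst r hr, norm_smul, Real.norm_of_nonneg (hwpos r hr).le]
    have h1 : w r ≤ r ^ (b / γ) := mul_le_of_le_one_right (by positivity) <|
      Real.exp_le_one_iff.2 (by
        have : 0 ≤ lam / γ * r⁻¹ := by positivity
        linarith)
    exact mul_le_mul h1 (hM r hr) (norm_nonneg _) (by positivity)
  exact (smul_eq_zero.1 (norm_le_zero_iff.1 hle)).resolve_left (hwpos s hs).ne'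

/-- In the quotient `E ⧸ S`, normed because `S` is closed, the image of `p` is a bounded solution of
the homogeneous equation, hence zero. -/
lemma mem_of_hasDerivAt_exponential {E : Type*} [NormedAddCommGroup E] [NormedSpace ℝ E]
    {S : Submodule ℝ E} (hS : IsClosed (S : Set E)) {γ b lam M : ℝ} (hγ : 0 < γ) (hb : 0 < b)
    (hlam : 0 < lam) {p p' : ℝ → E} (hp : ∀ s, 0 < s → HasDerivAt p (p' s) s)
    (hmem : ∀ s, 0 < s → (γ * s ^ 2) • p' s + (lam + b * s) • p s ∈ S)
    (hM : ∀ s, 0 < s → ‖p s‖ ≤ M) {s : ℝ} (hs : 0 < s) : p s ∈ S := by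
  let π : E →L[ℝ] E ⧸ S := S.mkQ.mkContinuous 1 fun x => by
    simpa using Submodule.Quotient.norm_mk_le S x
  have hπ : ∀ x, π x = 0 ↔ x ∈ S := fun x => Submodule.Quotient.mk_eq_zero S
  rw [← hπ]
  refine eq_zero_of_hasDerivAt_exponential (p := fun s => π (p s)) (p' := fun s => π (p' s))
    (M := M) hγ hb hlam (fun s hs => π.hasFDerivAt.comp_hasDerivAt s (hp s hs))
    (fun s hs => ?_) (fun s hs => (Submodule.Quotient.norm_mk_le S (p s)).trans (hM s hs)) hs
  rw [← map_smul, ← map_smul, ← map_add, hπ]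
  exact hmem s hs

lemma range_shiftedOperator {γ b lam : ℝ} (hγ : 0 < γ) (hb : 0 < b) (hlam : 0 < lam) :
    LinearMap.range (shiftedOperator 𝕜 γ b lam) = ⊤ := by
  set N := LinearMap.range (shiftedOperator 𝕜 γ b lam)
  have hcl : IsClosed (N : Set (CInfty 𝕜)) := isClosed_range_shiftedOperator hγ hb hlam
  refine eq_top_of_expElem_mem hcl fun k => ?_
  -- The differential equation covers only `s > 0`; for `k = 0` the constant `1` is in the range
  -- because `A 1 = 0`.
  rcases Nat.eq_zero_or_pos k with rfl | hk
  · have h := memDomain_expElem (𝕜 := 𝕜) γ b (s := 0) le_rfl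
    have h1 : shiftedOperator 𝕜 γ b lam ⟨expElem 𝕜 0, h.1⟩ ∈ N := LinearMap.mem_range_self _ _
    have h2 : shiftedOperator 𝕜 γ b lam ⟨expElem 𝕜 0, h.1⟩ = (lam : 𝕜) • expElem 𝕜 0 := by
      refine Subtype.ext (BoundedContinuousFunction.ext fun x => ?_)
      rw [shiftedOperator_apply, h.2 x, RCLike.real_smul_eq_coe_mul]
      change (lam : 𝕜) * (expElem 𝕜 0 : ℝ≥0 →ᵇ 𝕜) x - _ =
        (lam : 𝕜) * (expElem 𝕜 0 : ℝ≥0 →ᵇ 𝕜) x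
      simp
    rw [h2] at h1
    rw [Nat.cast_zero]
    exact (N.smul_mem_iff (RCLike.ofReal_ne_zero.2 hlam.ne')).1 h1
  · refine mem_of_hasDerivAt_exponential (S := N.restrictScalars ℝ) hcl (p := expElem 𝕜)
      (p' := fun s => if hs : 0 < s then -mulExpElem 𝕜 s hs else 0) hγ hb hlam
      (fun s hs => ?_) (fun s hs => ?_) (fun s _ => norm_expElem_le s) (Nat.cast_pos.2 hk)
    · rw [dif_pos hs]
      exact hasDerivAt_expElem hs
    · rw [dif_pos hs]
      have h := memDomain_expElem (𝕜 := 𝕜) γ b hs.le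
      refine ⟨⟨expElem 𝕜 s, h.1⟩, Subtype.ext (BoundedContinuousFunction.ext fun x => ?_)⟩
      rw [shiftedOperator_apply, h.2 x]
      change lam • (expElem 𝕜 s : ℝ≥0 →ᵇ 𝕜) x - _ =
        (γ * s ^ 2) • -(mulExpElem 𝕜 s hs : ℝ≥0 →ᵇ 𝕜) x +
          (lam + b * s) • (expElem 𝕜 s : ℝ≥0 →ᵇ 𝕜) x
      rw [expElem_apply hs.le, mulExpElem_apply]
      simp only [RCLike.real_smul_eq_coe_mul]
      push_cast
      ring

/-! ### The resolvent and its estimate -/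

lemma bijective_shiftedOperator {γ b lam : ℝ} (hγ : 0 < γ) (hb : 0 < b) (hlam : 0 < lam) :
    Function.Bijective (shiftedOperator 𝕜 γ b lam) := by
  refine ⟨(injective_iff_map_eq_zero _).2 fun u hu => ?_,
    LinearMap.range_eq_top.1 (range_shiftedOperator hγ hb hlam)⟩
  have h := mul_norm_le_norm_shiftedOperator hγ hb hlam u
  rw [hu, norm_zero] at h
  exact Subtype.ext (norm_le_zero_iff.1 (nonpos_of_mul_nonpos_right h hlam))

lemma mem_resolventSet_operatorA {γ b lam : ℝ} (hγ : 0 < γ) (hb : 0 < b) (hlam : 0 < lam) :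
    (lam : 𝕜) ∈ resolventSet (operatorA 𝕜 γ b) := by
  let e := LinearEquiv.ofBijective _ (bijective_shiftedOperator (𝕜 := 𝕜) hγ hb hlam)
  let R : CInfty 𝕜 →L[𝕜] CInfty 𝕜 :=
    ((operatorA 𝕜 γ b).domain.subtype ∘ₗ e.symm.toLinearMap).mkContinuous lam⁻¹ fun f => by
      have h := mul_norm_le_norm_shiftedOperator hγ hb hlam (e.symm f)
      rw [show shiftedOperator 𝕜 γ b lam (e.symm f) = f from e.apply_symm_apply f] at h
      rwa [inv_mul_eq_div, le_div_iff₀' hlam]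
  exact ⟨R, fun f => (e.symm f).2, fun f => e.apply_symm_apply f,
    fun u => congrArg Subtype.val (e.symm_apply_apply u)⟩

lemma isResolventAt_resolventOp {X : Type*} [NormedAddCommGroup X] [NormedSpace 𝕜 X]
    {A : X →ₗ.[𝕜] X} {z : 𝕜} (hz : z ∈ resolventSet A) : IsResolventAt A z (resolventOp A z) := by
  rw [resolventOp, dif_pos hz]
  exact Classical.choose_spec hz

/-- With `f = λ u - A u`, dissipativity gives `‖A u‖ ≤ λ ‖u‖ + ‖f‖ ≤ 2 ‖f‖`; the second-derivative
bound contributes the other factor `2`. -/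
lemma norm_mul_deriv_deriv_le_shiftedOperator {γ b lam : ℝ} (hγ : 0 < γ) (hb : 0 < b)
    (hlam : 0 < lam) (u : (operatorA 𝕜 γ b).domain) {x : ℝ} (hx : 0 < x) :
    ‖(x : 𝕜) * deriv (deriv (onReal ((u : CInfty 𝕜) : ℝ≥0 →ᵇ 𝕜))) x‖ ≤
      4 / γ * ‖shiftedOperator 𝕜 γ b lam u‖ := by
  have hu : MemDomain γ b ((u : CInfty 𝕜) : ℝ≥0 →ᵇ 𝕜) := u.2
  refine (hu.norm_mul_deriv_deriv_le hγ hb (M := 2 * ‖shiftedOperator 𝕜 γ b lam u‖)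
    (fun y => ?_) hx).trans_eq (by ring)
  have h1 := shiftedOperator_apply (lam := lam) u y
  have h2 := (shiftedOperator 𝕜 γ b lam u : ℝ≥0 →ᵇ 𝕜).norm_coe_le_norm y
  have h3 := ((u : CInfty 𝕜) : ℝ≥0 →ᵇ 𝕜).norm_coe_le_norm y
  have h4 : lam * ‖((u : CInfty 𝕜) : ℝ≥0 →ᵇ 𝕜)‖ ≤ ‖(shiftedOperator 𝕜 γ b lam u : ℝ≥0 →ᵇ 𝕜)‖ :=
    mul_norm_le_norm_shiftedOperator hγ hb hlam u
  have h5 : diffExpr γ b ((u : CInfty 𝕜) : ℝ≥0 →ᵇ 𝕜) y =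
      lam • ((u : CInfty 𝕜) : ℝ≥0 →ᵇ 𝕜) y - (shiftedOperator 𝕜 γ b lam u : ℝ≥0 →ᵇ 𝕜) y := by
    rw [h1, sub_sub_cancel]
  rw [h5]
  refine (norm_sub_le _ _).trans ?_
  rw [norm_smul, Real.norm_of_nonneg hlam.le]
  have h6 := mul_le_mul_of_nonneg_left h3 hlam.le
  change _ ≤ 2 * ‖(shiftedOperator 𝕜 γ b lam u : ℝ≥0 →ᵇ 𝕜)‖
  linarith

end DegenerateDiffusion

open DegenerateDiffusion in
theorem corollary5p4 (𝕜 : Type*) [RCLike 𝕜] (γ : ℝ) (hγ : 0 < γ) :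
    ∃ C : ℝ, 0 < C ∧ ∀ b : ℝ, 0 < b → ∀ lam : ℝ, 0 < lam →
      (lam : 𝕜) ∈ resolventSet (operatorA 𝕜 γ b) ∧
      ∀ f : CInfty 𝕜, ∀ x : ℝ, 0 < x →
        ‖(x : 𝕜) * deriv (deriv (onReal
            (resolventOp (operatorA 𝕜 γ b) (lam : 𝕜) f : ℝ≥0 →ᵇ 𝕜))) x‖ ≤
          C / γ * (1 + max (2 * b / γ) 1) * ‖f‖ := by
  -- The bracket is always at least `2`, so `C = 2` dominates the `b`-independent constant `4 / γ`.
  refine ⟨2, two_pos, fun b hb lam hlam => ?_⟩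
  have hmem := mem_resolventSet_operatorA (𝕜 := 𝕜) hγ hb hlam
  refine ⟨hmem, fun f x hx => ?_⟩
  have hR := isResolventAt_resolventOp hmem
  have h := norm_mul_deriv_deriv_le_shiftedOperator hγ hb hlam ⟨_, hR.mem_domain f⟩ hx
  rw [show shiftedOperator 𝕜 γ b lam ⟨_, hR.mem_domain f⟩ = f from hR.right_inv f] at h
  refine h.trans ?_
  have h1 : 2 ≤ 1 + max (2 * b / γ) 1 := by linarith [le_max_right (2 * b / γ) 1]
  calc 4 / γ * ‖f‖ = 2 / γ * 2 * ‖f‖ := by ring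
    _ ≤ _ := by gcongr
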